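/- Let $N\ge 3$, $0<\mu<2$, $\alpha>0$, $M>0$, and let $\mathcal G$ be the star graph made of $N$ halflines $[0,+\infty)$ glued at their origin $\mathrm v$. For $\Phi=(\phi_1,\dots,\phi_N)\in H^1(\mathcal G)$ put $$Q(\Phi)=\|\Phi\|_{L^2(\mathcal G)}^2,\qquad E(\Phi,\mathcal G)=\tfrac12\|\Phi'\|_{L^2(\mathcal G)}^2-\tfrac1{2\mu+2}\|\Phi\|_{L^{2\mu+2}(\mathcal G)}^{2\mu+2}-\tfrac{\alpha}{2}|\Phi(\mathrm v)|^2 .$$ For $\omega>0$ let $\phi_\omega(x)=[(\mu+1)\omega]^{\frac1{2\mu}}\operatorname{sech}^{\frac1\mu}(\mu\sqrt\omega\,x)$. (i) For all $m,a>0$ there is a unique pair $(\omega,\xi)=(\omega(m,a),\xi(m,a))\in(0,\infty)\times\mathbb R$ with $\int_0^{\infty}\phi_\omega^2(x+\xi)\,dx=m$ and $\phi_\omega(\xi)=a$. For $\underline m=(m_1,\dots,m_{N-1})\in(0,\infty)^{N-1}$ with $\sum_{i=1}^{N-1} m_i<M$ and $a>0$, put $m_N=M-\sum_{i=1}^{N-1}m_i$,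 let $\Phi_{\underline m,a}$ be the function on $\mathcal G$ whose $i$-th component is $\phi_{\omega(m_i,a)}(\cdot+\xi(m_i,a))$, $i=1,\dots,N$, and let $E_r(\underline m,a)=E(\Phi_{\underline m,a},\mathcal G)$ be the reduced energy. (ii) There is exactly one $\omega>\alpha^2/N^2$ such that the symmetric state $\Psi_\omega$, given on every edge by $\phi_\omega(\cdot+\zeta)$ with $\zeta=\frac1{\mu\sqrt\omega}\operatorname{arctanh}\big(\frac{\alpha}{N\sqrt\omega}\big)$, satisfies $Q(\Psi_\omega)=M$. (iii) For this $\omega$, let $\widetilde a=\Psi_\omega(\mathrm v)=\phi_\omega(\zeta)$ and $\widetilde P=(M/N,\dots,M/N,\widetilde a)$. Then $\widetilde P$ lies in the domain of $E_r$, $\Phi_{\widetilde P}=\Psi_\omega$, and $\widetilde P$ is a strict local minimum of $E_r$. Moreover $E_r$ is of class $C^2$ near $\widetilde P$, its gradient vanishes at $\widetilde P$, and its Hessian at $\widetilde P$ is positive definite. -/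

import Mathlib

open Set Filter Topology MeasureTheory

noncomputable section

/-- The NLS soliton of frequency `ω` for the nonlinearity of power `2μ + 1`:
`φ_ω(x) = [(μ+1) ω]^{1/(2μ)} sech^{1/μ}(μ √ω x)`. -/
def soliton (μ ω x : ℝ) : ℝ :=
  ((μ + 1) * ω) ^ (1 / (2 * μ)) * (1 / Real.cosh (μ * Real.sqrt ω * x)) ^ (1 / μ)

/-- A function on the star graph with `N` halflines: the `j`-th component is the function on the
`j`-th edge `[0, ∞)`. Components are total functions on `ℝ`, of which only the values on
`[0, ∞)` are relevant; the vertex is the common point `0` of the edges. -/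
abbrev StarFun (N : ℕ) : Type := Fin N → ℝ → ℂ

/-- The mass `Q(Φ) = ‖Φ‖²` in `L²` of the star graph. -/
def starMass {N : ℕ} (Φ : StarFun N) : ℝ :=
  ∑ j, ∫ x in Ioi (0 : ℝ), ‖Φ j x‖ ^ 2

/-- The NLS energy on the star graph with a delta interaction of strength `-α` at the vertex:
`E(Φ) = ½ ‖Φ'‖₂² - 1/(2μ+2) ‖Φ‖_{2μ+2}^{2μ+2} - (α/2) |Φ(v)|²`.
For the continuous representative of an `H¹` function, `deriv` is the weak derivative a.e.,
and the vertex value `Φ(v)` is the value at `0` of any component. -/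
def starEnergy (N : ℕ) [NeZero N] (μ α : ℝ) (Φ : StarFun N) : ℝ :=
  1 / 2 * ∑ j, (∫ x in Ioi (0 : ℝ), ‖deriv (Φ j) x‖ ^ 2)
    - 1 / (2 * μ + 2) * ∑ j, (∫ x in Ioi (0 : ℝ), ‖Φ j x‖ ^ (2 * μ + 2))
    - α / 2 * ‖Φ 0 0‖ ^ 2

/-- `p = (ω, ξ)` are the parameters of a soliton piece `φ_ω(· + ξ)` on the halfline with
mass `m` and value `a` at the origin. -/
def IsSolitonParam (μ m a : ℝ) (p : ℝ × ℝ) : Prop :=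
  0 < p.1 ∧ (∫ x in Ioi (0 : ℝ), soliton μ p.1 (x + p.2) ^ 2) = m ∧ soliton μ p.1 p.2 = a

/-- The pair `(ω(m, a), ξ(m, a))` of soliton parameters determined by the mass `m > 0` on the
halfline and the value `a > 0` at the origin. -/
def solitonParam (μ m a : ℝ) : ℝ × ℝ :=
  Classical.epsilon (IsSolitonParam μ m a)

/-- The piece of soliton `φ_{ω(m,a)}(x + ξ(m,a))`. -/
def solitonPiece (μ m a x : ℝ) : ℝ :=
  soliton μ (solitonParam μ m a).1 (x + (solitonParam μ m a).2)

/-- The masses on the `N` edges: `m_1, …, m_{N-1}` on the first `N - 1` edges and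
`M - ∑ m_j` on the last one. -/
def edgeMass (N : ℕ) (M : ℝ) (m : Fin (N - 1) → ℝ) (i : Fin N) : ℝ :=
  if h : (i : ℕ) < N - 1 then m ⟨i, h⟩ else M - ∑ j, m j

/-- The multi-soliton `Φ_{m,a}` of total mass `M`. -/
def multiSoliton (N : ℕ) (μ M : ℝ) (P : (Fin (N - 1) → ℝ) × ℝ) : StarFun N :=
  fun i x => ((solitonPiece μ (edgeMass N M P.1 i) P.2 x : ℝ) : ℂ)

/-- The domain of the reduced energy: the parameters `(m_1, …, m_{N-1}, a)` of the
multi-solitons of mass `M`. -/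
def reducedDomain (N : ℕ) (M : ℝ) : Set ((Fin (N - 1) → ℝ) × ℝ) :=
  {P | (∀ i, 0 < P.1 i) ∧ ∑ i, P.1 i < M ∧ 0 < P.2}

/-- The reduced energy `E_r(m, a) = E(Φ_{m,a})`. -/
def reducedEnergy (N : ℕ) [NeZero N] (μ α M : ℝ) (P : (Fin (N - 1) → ℝ) × ℝ) : ℝ :=
  starEnergy N μ α (multiSoliton N μ M P)

/-- The shift `ζ = artanh(α / (N √ω)) / (μ √ω)` of the symmetric bound state. -/
def symShift (N : ℕ) (μ α ω : ℝ) : ℝ :=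
  1 / (μ * Real.sqrt ω) * Real.artanh (α / (N * Real.sqrt ω))

/-- The symmetric bound state `Ψ_ω`, equal to `φ_ω(· + ζ)` on every edge. -/
def symState (N : ℕ) (μ α ω : ℝ) : StarFun N :=
  fun _ x => ((soliton μ ω (x + symShift N μ α ω) : ℝ) : ℂ)

/-- The point `P̃ = (M/N, …, M/N, ã)`, where `ã = φ_ω(ζ)` is the value of `Ψ_ω` at the vertex. -/
def symPoint (N : ℕ) (μ α M ω : ℝ) : (Fin (N - 1) → ℝ) × ℝ :=
  (fun _ => M / N, soliton μ ω (symShift N μ α ω))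

end

/-!
Everything becomes explicit in terms of the phase `u = μ √ω ξ` of a piece of soliton
`φ_ω(· + ξ)` on the halfline. Its value `a` at the vertex fixes the frequency,
`(μ + 1) ω = a^{2μ} cosh² u` (`soliton_eq_iff`), and after eliminating `ω` its mass is
`m = (√(μ+1)/μ) a^{2-μ} exp (-h(u))`, where `exp (-h(u)) = cosh(u)^{q-1} ∫_u^∞ sech^q` and
`q = 2/μ > 1` (`soliton_mass_eq`). The function `h` is `massCoord q`. It is a smooth increasing
bijection of the line with positive derivative, because `tanh u ∫_u^∞ sech^q < sech^q(u) / q`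
(`tanh_mul_sechTail_lt`). Inverting it gives existence, uniqueness and smoothness of the
parameters `(ω, ξ)` as functions of `(m, a)` (`isSolitonParam_iff`).

The integrals in the energy of a piece reduce to its mass by the recursion for
`∫_u^∞ sech^{q+2}` (`sechTail_add_two`), which makes this energy an explicit function `e(m, a)`
(`energy_soliton`) with `∂e/∂m = -ω/2` and `∂e/∂a = -φ'(0) = √ω tanh(u) a`
(`hasDerivAt_pieceEnergy`). The reduced energy is the sum of the `e(m_i, a)` minus
`α a² / 2` (`reducedEnergy_eq`). At the symmetric point all frequencies agree and
`N √ω tanh u = α`, hence the gradient vanishes. The variations of the edge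
masses have zero sum, so the Hessian has no mixed term between masses and `a` there
(`fderiv_fderiv_reducedEnergy`): it is `-½ ∂ω/∂m` times the sum of squares of the variations of the
edge masses, plus `N a ∂(√ω tanh u)/∂a` times the square of the variation of `a`. The first
coefficient is positive because `ω` is increasing in `|u|`, `u` is decreasing in `m`, and `u > 0` as
`α > 0`. The second is positive because `√ω tanh u` is proportional to `a^μ sinh u`, where `u > 0`
increases with `a`, as `μ < 2`. Strict minimality is then the second derivative test
(`eventually_lt_of_fderiv_fderiv_pos`).

The symmetric states have phase `u = artanh (α / (N √ω))`, and their mass is a positive constant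
times `√ω^{q-1} ∫_u^∞ sech^q`. It is strictly increasing in `ω`, and along
`√ω = α / (N tanh u)`, `u > 0`, it takes all positive values.
-/

/-! ### Tail integrals of powers of the hyperbolic secant -/

theorem hasDerivAt_cosh_rpow (q x : ℝ) :
    HasDerivAt (fun x => Real.cosh x ^ q) (q * Real.cosh x ^ q * Real.tanh x) x := by
  have h := (Real.hasDerivAt_cosh x).rpow_const (p := q) (Or.inl (Real.cosh_pos x).ne')
  refine h.congr_deriv ?_
  rw [Real.rpow_sub_one (Real.cosh_pos x).ne', Real.tanh_eq_sinh_div_cosh]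
  ring

theorem hasDerivAt_tanh (x : ℝ) : HasDerivAt Real.tanh (1 - Real.tanh x ^ 2) x := by
  have h := (Real.hasDerivAt_sinh x).div (Real.hasDerivAt_cosh x) (Real.cosh_pos x).ne'
  have e : Real.tanh = fun x => Real.sinh x / Real.cosh x := by
    funext x; exact Real.tanh_eq_sinh_div_cosh x
  rw [e]
  refine h.congr_deriv ?_
  field_simp

theorem one_sub_tanh_sq (x : ℝ) : 1 - Real.tanh x ^ 2 = 1 / Real.cosh x ^ 2 := by
  rw [Real.tanh_eq_sinh_div_cosh]
  field_simp
  linarith [Real.cosh_sq x]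

theorem tanh_pos {x : ℝ} (hx : 0 < x) : 0 < Real.tanh x := by
  rw [Real.tanh_eq_sinh_div_cosh]
  exact div_pos (Real.sinh_pos_iff.2 hx) (Real.cosh_pos x)

theorem contDiff_cosh_rpow (q : ℝ) {n : WithTop ℕ∞} :
    ContDiff ℝ n (fun x => Real.cosh x ^ q) :=
  Real.contDiff_cosh.rpow_const_of_ne fun x => (Real.cosh_pos x).ne'

theorem cosh_rpow_neg_le {q : ℝ} (hq : 0 < q) (x : ℝ) :
    Real.cosh x ^ (-q) ≤ 2 ^ q * Real.exp (-q * x) := by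
  have h1 : Real.exp x / 2 ≤ Real.cosh x := by
    rw [Real.cosh_eq]; linarith [Real.exp_pos (-x)]
  calc Real.cosh x ^ (-q) ≤ (Real.exp x / 2) ^ (-q) :=
        Real.rpow_le_rpow_of_nonpos (by positivity) h1 (by linarith)
    _ = 2 ^ q * Real.exp (-q * x) := by
        rw [Real.div_rpow (Real.exp_pos x).le (by norm_num), ← Real.exp_mul,
          Real.rpow_neg (by norm_num : (0 : ℝ) ≤ 2)]
        rw [div_inv_eq_mul, mul_comm x, mul_comm]

theorem integrableOn_cosh_rpow {q : ℝ} (hq : 0 < q) (u : ℝ) :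
    IntegrableOn (fun x => Real.cosh x ^ (-q)) (Ioi u) := by
  have h : IntegrableOn (fun x => 2 ^ q * Real.exp (-q * x)) (Ioi u) :=
    (integrableOn_exp_mul_Ioi (by linarith) u).const_mul _
  refine h.mono' (contDiff_cosh_rpow (-q) (n := 0)).continuous.aestronglyMeasurable ?_
  filter_upwards with x
  rw [Real.norm_of_nonneg (Real.rpow_nonneg (Real.cosh_pos x).le _)]
  exact cosh_rpow_neg_le hq x

theorem tendsto_cosh_rpow_atTop {q : ℝ} (hq : 0 < q) :
    Tendsto (fun x => Real.cosh x ^ (-q)) atTop (𝓝 0) := by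
  have h : Tendsto (fun x => (2 : ℝ) ^ q * Real.exp (-q * x)) atTop (𝓝 (2 ^ q * 0)) := by
    refine Tendsto.const_mul _ (Real.tendsto_exp_atBot.comp ?_)
    exact tendsto_id.const_mul_atTop_of_neg (by linarith)
  rw [mul_zero] at h
  exact squeeze_zero (fun x => Real.rpow_nonneg (Real.cosh_pos x).le _) (cosh_rpow_neg_le hq) h

/-- The tail integral `∫_u^∞ sech^q`. -/
noncomputable def sechTail (q u : ℝ) : ℝ := ∫ x in Ioi u, Real.cosh x ^ (-q)

theorem hasDerivAt_sechTail {q : ℝ} (hq : 0 < q) (u : ℝ) :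
    HasDerivAt (sechTail q) (-Real.cosh u ^ (-q)) u := by
  have hc : Continuous fun x => Real.cosh x ^ (-q) := (contDiff_cosh_rpow (-q) (n := 0)).continuous
  have e : sechTail q = fun u => sechTail q 0 - ∫ x in (0 : ℝ)..u, Real.cosh x ^ (-q) := by
    funext u
    have := intervalIntegral.integral_interval_add_Ioi' (hc.intervalIntegrable 0 u)
      (integrableOn_cosh_rpow hq u)
    simp only [sechTail]
    linarith
  rw [e]
  exact (hc.integral_hasStrictDerivAt 0 u).hasDerivAt.const_sub _

theorem contDiff_sechTail {q : ℝ} (hq : 0 < q) : ContDiff ℝ (⊤ : ℕ∞) (sechTail q) := by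
  rw [contDiff_infty_iff_deriv]
  refine ⟨fun u => (hasDerivAt_sechTail hq u).differentiableAt, ?_⟩
  rw [show deriv (sechTail q) = fun u => -Real.cosh u ^ (-q) from
    funext fun u => (hasDerivAt_sechTail hq u).deriv]
  exact (contDiff_cosh_rpow (-q)).neg

theorem sechTail_strictAnti {q : ℝ} (hq : 0 < q) : StrictAnti (sechTail q) :=
  strictAnti_of_hasDerivAt_neg (hasDerivAt_sechTail hq)
    fun u => neg_neg_of_pos (Real.rpow_pos_of_pos (Real.cosh_pos u) _)

theorem sechTail_pos {q : ℝ} (hq : 0 < q) (u : ℝ) : 0 < sechTail q u := by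
  have h : 0 ≤ sechTail q (u + 1) :=
    integral_nonneg fun x => Real.rpow_nonneg (Real.cosh_pos x).le _
  exact h.trans_lt (sechTail_strictAnti hq (by linarith))

theorem tendsto_sechTail_atTop {q : ℝ} (hq : 0 < q) : Tendsto (sechTail q) atTop (𝓝 0) := by
  have h : Tendsto (fun u => ∫ x in (0 : ℝ)..u, Real.cosh x ^ (-q)) atTop (𝓝 (sechTail q 0)) :=
    intervalIntegral_tendsto_integral_Ioi 0 (integrableOn_cosh_rpow hq 0) tendsto_id
  have h2 := h.const_sub (sechTail q 0)
  rw [sub_self] at h2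
  refine h2.congr fun u => ?_
  have := intervalIntegral.integral_interval_add_Ioi'
    ((contDiff_cosh_rpow (-q) (n := 0)).continuous.intervalIntegrable 0 u)
    (integrableOn_cosh_rpow hq u)
  simp only [sechTail]
  linarith

theorem integrableOn_cosh_rpow_add_two {q : ℝ} (hq : 0 < q) (u : ℝ) :
    IntegrableOn (fun x => Real.cosh x ^ (-(q + 2))) (Ioi u) :=
  integrableOn_cosh_rpow (by linarith) u

theorem cosh_rpow_add_two (q x : ℝ) :
    Real.cosh x ^ (-(q + 2)) = Real.cosh x ^ (-q) * (1 - Real.tanh x ^ 2) := by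
  rw [one_sub_tanh_sq, neg_add, Real.rpow_add (Real.cosh_pos x),
    Real.rpow_neg (Real.cosh_pos x).le 2, Real.rpow_two, one_div]

/-- The reduction formula obtained by integrating the derivative of `sech^q tanh`. -/
theorem sechTail_add_two {q : ℝ} (hq : 0 < q) (u : ℝ) :
    (q + 1) * sechTail (q + 2) u = q * sechTail q u - Real.cosh u ^ (-q) * Real.tanh u := by
  have hd : ∀ x ∈ Ici u, HasDerivAt (fun x => Real.cosh x ^ (-q) * Real.tanh x)
      ((q + 1) * Real.cosh x ^ (-(q + 2)) - q * Real.cosh x ^ (-q)) x := fun x _ => by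
    refine ((hasDerivAt_cosh_rpow (-q) x).mul (hasDerivAt_tanh x)).congr_deriv ?_
    rw [cosh_rpow_add_two]
    ring
  have hi1 := (integrableOn_cosh_rpow_add_two hq u).const_mul (q + 1)
  have hi2 := (integrableOn_cosh_rpow hq u).const_mul q
  have ht : Tendsto (fun x => Real.cosh x ^ (-q) * Real.tanh x) atTop (𝓝 0) := by
    refine squeeze_zero_norm (fun x => ?_) (tendsto_cosh_rpow_atTop hq)
    rw [norm_mul, Real.norm_of_nonneg (Real.rpow_nonneg (Real.cosh_pos x).le _)]
    exact mul_le_of_le_one_right (Real.rpow_nonneg (Real.cosh_pos x).le _)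
      (Real.abs_tanh_lt_one x).le
  have h := integral_Ioi_of_hasDerivAt_of_tendsto' hd (hi1.sub hi2) ht
  rw [integral_sub hi1 hi2, integral_const_mul, integral_const_mul] at h
  simp only [sechTail]
  linarith

/-- The right side minus the left side decreases to `0` at infinity. This inequality is the
monotonicity of the mass of a piece of soliton in its phase, at a given vertex value. -/
theorem tanh_mul_sechTail_lt {q : ℝ} (hq : 0 < q) (u : ℝ) :
    Real.tanh u * sechTail q u < Real.cosh u ^ (-q) / q := by
  set K : ℝ → ℝ := fun u => Real.cosh u ^ (-q) / q - Real.tanh u * sechTail q u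
  have hd : ∀ x, HasDerivAt K (-((1 - Real.tanh x ^ 2) * sechTail q x)) x := fun x => by
    refine (((hasDerivAt_cosh_rpow (-q) x).div_const q).sub
      ((hasDerivAt_tanh x).mul (hasDerivAt_sechTail hq x))).congr_deriv ?_
    field_simp
    ring
  have hanti : StrictAnti K := strictAnti_of_hasDerivAt_neg hd fun x =>
    neg_neg_of_pos (mul_pos (by rw [one_sub_tanh_sq]; have := Real.cosh_pos x; positivity)
      (sechTail_pos hq x))
  have ht : Tendsto K atTop (𝓝 0) := by
    have h1 := (tendsto_cosh_rpow_atTop hq).div_const q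
    have h2 : Tendsto (fun x => Real.tanh x * sechTail q x) atTop (𝓝 0) := by
      refine squeeze_zero_norm (fun x => ?_) (tendsto_sechTail_atTop hq)
      rw [norm_mul, Real.norm_of_nonneg (sechTail_pos hq x).le]
      exact mul_le_of_le_one_left (sechTail_pos hq x).le (Real.abs_tanh_lt_one x).le
    simpa using h1.sub h2
  have h0 : 0 ≤ K (u + 1) := hanti.antitone.le_of_tendsto ht _
  have : 0 < K u := h0.trans_lt (hanti (by linarith))
  linarith

/-! ### The mass coordinate -/

/-- Minus the logarithm of `cosh(u)^{q-1} ∫_u^∞ sech^q`. With `q = 2/μ`, the mass of a piece of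
soliton with vertex value `a` and phase `u = μ √ω ξ` is
`(√(μ+1)/μ) a^{2-μ} exp (-massCoord q u)`. -/
noncomputable def massCoord (q u : ℝ) : ℝ :=
  -((q - 1) * Real.log (Real.cosh u) + Real.log (sechTail q u))

/-- The derivative of `massCoord q`. -/
noncomputable def massCoordDeriv (q u : ℝ) : ℝ :=
  Real.cosh u ^ (-q) / sechTail q u - (q - 1) * Real.tanh u

theorem hasDerivAt_massCoord {q : ℝ} (hq : 0 < q) (u : ℝ) :
    HasDerivAt (massCoord q) (massCoordDeriv q u) u := by
  have h := (((Real.hasDerivAt_cosh u).log (Real.cosh_pos u).ne').const_mul (q - 1)).add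
    ((hasDerivAt_sechTail hq u).log (sechTail_pos hq u).ne')
  refine h.neg.congr_deriv ?_
  rw [massCoordDeriv, Real.tanh_eq_sinh_div_cosh]
  ring

theorem massCoordDeriv_pos {q : ℝ} (hq : 1 < q) (u : ℝ) : 0 < massCoordDeriv q u := by
  have hJ := sechTail_pos (by linarith : 0 < q) u
  have hc := Real.rpow_pos_of_pos (Real.cosh_pos u) (-q)
  have h := tanh_mul_sechTail_lt (by linarith : 0 < q) u
  rw [massCoordDeriv, sub_pos, lt_div_iff₀ hJ]
  rw [lt_div_iff₀ (by linarith)] at h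
  rcases le_total (Real.tanh u * sechTail q u) 0 with h0 | h0
  · nlinarith
  · nlinarith

theorem contDiff_massCoord {q : ℝ} (hq : 0 < q) : ContDiff ℝ (⊤ : ℕ∞) (massCoord q) :=
  ((contDiff_const.mul (Real.contDiff_cosh.log fun u => (Real.cosh_pos u).ne')).add
    ((contDiff_sechTail hq).log fun u => (sechTail_pos hq u).ne')).neg

theorem massCoord_strictMono {q : ℝ} (hq : 1 < q) : StrictMono (massCoord q) :=
  strictMono_of_hasDerivAt_pos (hasDerivAt_massCoord (by linarith)) (massCoordDeriv_pos hq)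

theorem massCoord_surjective {q : ℝ} (hq : 1 < q) : Function.Surjective (massCoord q) := by
  have hq0 : 0 < q := by linarith
  have hsinh : Tendsto Real.sinh atTop atTop := Real.sinhOrderIso.tendsto_atTop
  refine (contDiff_massCoord hq0).continuous.surjective ?_ ?_
  -- at `+∞`, `tanh u ∫_u^∞ sech^q < sech^q(u) / q` gives `massCoord q u ≥ log (q sinh u)`
  · have h1 : Tendsto (fun u => Real.log (q * Real.sinh u)) atTop atTop :=
      Real.tendsto_log_atTop.comp (hsinh.const_mul_atTop hq0)
    refine tendsto_atTop_mono' _ ?_ h1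
    filter_upwards [eventually_gt_atTop 0] with u hu
    have hc := Real.cosh_pos u
    have hJ := sechTail_pos hq0 u
    have h := tanh_mul_sechTail_lt hq0 u
    have e : massCoord q u = Real.log ((Real.cosh u ^ (q - 1) * sechTail q u)⁻¹) := by
      rw [Real.log_inv, Real.log_mul (by positivity) hJ.ne', Real.log_rpow hc, massCoord]
    rw [e]
    refine Real.log_le_log (by positivity) ?_
    rw [le_inv_comm₀ (by positivity) (by positivity)]
    rw [lt_div_iff₀ hq0, Real.tanh_eq_sinh_div_cosh, Real.rpow_neg hc.le] at h
    rw [Real.rpow_sub_one hc.ne', inv_eq_one_div, le_div_iff₀ (by positivity)]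
    have h2 := mul_le_mul_of_nonneg_left h.le (Real.rpow_pos_of_pos hc q).le
    rw [mul_inv_cancel₀ (by positivity)] at h2
    refine le_trans (le_of_eq ?_) h2
    ring
  -- at `-∞` the tail integral stays above its value at `0`, and `cosh^{q-1}` is unbounded
  · have hcosh : Tendsto Real.cosh atBot atTop := by
      have : Tendsto (fun u => Real.sinh (-u)) atBot atTop := hsinh.comp tendsto_neg_atBot_atTop
      refine tendsto_atTop_mono (fun u => ?_) this
      rw [← Real.cosh_neg]
      exact (Real.sinh_lt_cosh _).le
    have h1 : Tendsto (fun u => -((q - 1) * Real.log (Real.cosh u) + Real.log (sechTail q 0)))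
        atBot atBot :=
      tendsto_neg_atTop_atBot.comp (tendsto_atTop_add_const_right _ _
        ((Real.tendsto_log_atTop.comp hcosh).const_mul_atTop (by linarith)))
    refine tendsto_atBot_mono' _ ?_ h1
    filter_upwards [eventually_le_atBot 0] with u hu
    have := Real.log_le_log (sechTail_pos hq0 0) ((sechTail_strictAnti hq0).antitone hu)
    simp only [massCoord]
    linarith

/-- The inverse of the mass coordinate. `Function.invFun` avoids carrying the hypothesis `1 < q`,
under which it is a two-sided inverse. -/
noncomputable def massCoordInv (q : ℝ) : ℝ → ℝ := Function.invFun (massCoord q)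

theorem massCoord_massCoordInv {q : ℝ} (hq : 1 < q) (y : ℝ) :
    massCoord q (massCoordInv q y) = y :=
  Function.rightInverse_invFun (massCoord_surjective hq) y

theorem massCoordInv_massCoord {q : ℝ} (hq : 1 < q) (u : ℝ) :
    massCoordInv q (massCoord q u) = u :=
  Function.leftInverse_invFun (massCoord_strictMono hq).injective u

/-- The mass coordinate as a homeomorphism of the line. -/
noncomputable def massCoordHomeomorph {q : ℝ} (hq : 1 < q) : ℝ ≃ₜ ℝ :=
  ((massCoord_strictMono hq).orderIsoOfSurjective _ (massCoord_surjective hq)).toHomeomorph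

theorem massCoordHomeomorph_symm {q : ℝ} (hq : 1 < q) :
    ⇑(massCoordHomeomorph hq).symm = massCoordInv q := by
  funext y
  rw [Homeomorph.symm_apply_eq]
  exact (massCoord_massCoordInv hq y).symm

theorem contDiff_massCoordInv {q : ℝ} (hq : 1 < q) : ContDiff ℝ (⊤ : ℕ∞) (massCoordInv q) := by
  rw [← massCoordHomeomorph_symm hq]
  exact (massCoordHomeomorph hq).contDiff_symm_deriv (fun u => (massCoordDeriv_pos hq u).ne')
    (hasDerivAt_massCoord (by linarith)) (contDiff_massCoord (by linarith))

theorem hasDerivAt_massCoordInv {q : ℝ} (hq : 1 < q) (y : ℝ) :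
    HasDerivAt (massCoordInv q) (massCoordDeriv q (massCoordInv q y))⁻¹ y :=
  HasDerivAt.of_local_left_inverse (contDiff_massCoordInv hq).continuous.continuousAt
    (hasDerivAt_massCoord (by linarith) _) (massCoordDeriv_pos hq _).ne'
    (Eventually.of_forall (massCoord_massCoordInv hq))

/-! ### Mass and energy of a piece of soliton -/

theorem integral_Ioi_comp_mul_add (f : ℝ → ℝ) {κ : ℝ} (hκ : 0 < κ) (ξ : ℝ) :
    ∫ x in Ioi (0 : ℝ), f (κ * (x + ξ)) = κ⁻¹ * ∫ x in Ioi (κ * ξ), f x := by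
  have h := (measurePreserving_add_right (volume : Measure ℝ) ξ).setIntegral_preimage_emb
    (measurableEmbedding_addRight ξ) (fun y => f (κ * y)) (Ioi ξ)
  rw [show (fun x : ℝ => x + ξ) ⁻¹' Ioi ξ = Ioi 0 by ext x; simp] at h
  rw [h, integral_comp_mul_left_Ioi f ξ hκ, smul_eq_mul]

section Soliton

variable {μ ω : ℝ}

theorem soliton_eq (μ ω x : ℝ) : soliton μ ω x =
    ((μ + 1) * ω) ^ (1 / (2 * μ)) * Real.cosh (μ * Real.sqrt ω * x) ^ (-(1 / μ)) := by
  rw [soliton, one_div (Real.cosh _), Real.inv_rpow (Real.cosh_pos _).le,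
    Real.rpow_neg (Real.cosh_pos _).le]

theorem soliton_pos (hμ : 0 < μ) (hω : 0 < ω) (x : ℝ) : 0 < soliton μ ω x := by
  rw [soliton_eq]
  positivity

theorem soliton_sq (hμ : 0 < μ) (hω : 0 < ω) (x : ℝ) : soliton μ ω x ^ 2 =
    ((μ + 1) * ω) ^ (1 / μ) * Real.cosh (μ * Real.sqrt ω * x) ^ (-(2 / μ)) := by
  have hc := Real.cosh_pos (μ * Real.sqrt ω * x)
  rw [soliton_eq, mul_pow, ← Real.rpow_mul_natCast (by positivity), ← Real.rpow_mul_natCast hc.le]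
  congr 2
  · push_cast; field_simp
  · push_cast; field_simp

theorem soliton_rpow (hμ : 0 < μ) (hω : 0 < ω) (x : ℝ) : soliton μ ω x ^ (2 * μ + 2) =
    ((μ + 1) * ω) ^ (1 / μ) * ((μ + 1) * ω) *
      Real.cosh (μ * Real.sqrt ω * x) ^ (-(2 / μ + 2)) := by
  have hc := Real.cosh_pos (μ * Real.sqrt ω * x)
  rw [soliton_eq, Real.mul_rpow (by positivity) (by positivity), ← Real.rpow_mul (by positivity),
    ← Real.rpow_mul hc.le, ← Real.rpow_add_one (by positivity)]
  congr 2
  · field_simp; ring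
  · field_simp; ring

/-- Given the phase `μ √ω x`, the value at `x` determines the frequency. -/
theorem soliton_eq_iff (hμ : 0 < μ) (hω : 0 < ω) {a : ℝ} (ha : 0 < a) (x : ℝ) :
    soliton μ ω x = a ↔
      (μ + 1) * ω = a ^ (2 * μ) * Real.cosh (μ * Real.sqrt ω * x) ^ 2 := by
  have hc := Real.cosh_pos (μ * Real.sqrt ω * x)
  have hs := soliton_pos hμ hω x
  have h1 : soliton μ ω x ^ (2 * μ) =
      (μ + 1) * ω / Real.cosh (μ * Real.sqrt ω * x) ^ 2 := by
    rw [soliton_eq, Real.mul_rpow (by positivity) (by positivity), ← Real.rpow_mul (by positivity),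
      ← Real.rpow_mul hc.le, show 1 / (2 * μ) * (2 * μ) = 1 by field_simp,
      show -(1 / μ) * (2 * μ) = -2 by field_simp, Real.rpow_one, Real.rpow_neg hc.le,
      Real.rpow_two, div_eq_mul_inv]
  rw [← Real.rpow_left_inj hs.le ha.le (by positivity : 2 * μ ≠ 0), h1,
    div_eq_iff (by positivity)]

theorem hasDerivAt_soliton (hμ : 0 < μ) (x : ℝ) :
    HasDerivAt (soliton μ ω)
      (-(Real.sqrt ω * Real.tanh (μ * Real.sqrt ω * x) * soliton μ ω x)) x := by
  have h1 : HasDerivAt (fun x => μ * Real.sqrt ω * x) (μ * Real.sqrt ω) x := by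
    simpa using (hasDerivAt_id x).const_mul (μ * Real.sqrt ω)
  have h2 := ((hasDerivAt_cosh_rpow (-(1 / μ)) (μ * Real.sqrt ω * x)).comp x h1).const_mul
    (((μ + 1) * ω) ^ (1 / (2 * μ)))
  have e : soliton μ ω = fun x => ((μ + 1) * ω) ^ (1 / (2 * μ)) *
      ((fun x => Real.cosh x ^ (-(1 / μ))) ∘ fun x => μ * Real.sqrt ω * x) x := by
    funext x; exact soliton_eq μ ω x
  rw [e]
  refine h2.congr_deriv ?_
  simp only [Function.comp]
  field_simp

theorem integral_soliton_sq (hμ : 0 < μ) (hω : 0 < ω) (ξ : ℝ) :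
    ∫ x in Ioi (0 : ℝ), soliton μ ω (x + ξ) ^ 2 =
      ((μ + 1) * ω) ^ (1 / μ) * ((μ * Real.sqrt ω)⁻¹ * sechTail (2 / μ) (μ * Real.sqrt ω * ξ)) := by
  simp_rw [soliton_sq hμ hω]
  rw [integral_const_mul, integral_Ioi_comp_mul_add (fun y => Real.cosh y ^ (-(2 / μ)))
    (mul_pos hμ (Real.sqrt_pos.2 hω)), sechTail]

theorem integral_soliton_rpow (hμ : 0 < μ) (hω : 0 < ω) (ξ : ℝ) :
    ∫ x in Ioi (0 : ℝ), soliton μ ω (x + ξ) ^ (2 * μ + 2) =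
      ((μ + 1) * ω) ^ (1 / μ) * ((μ + 1) * ω) *
        ((μ * Real.sqrt ω)⁻¹ * sechTail (2 / μ + 2) (μ * Real.sqrt ω * ξ)) := by
  simp_rw [soliton_rpow hμ hω]
  rw [integral_const_mul, integral_Ioi_comp_mul_add (fun y => Real.cosh y ^ (-(2 / μ + 2)))
    (mul_pos hμ (Real.sqrt_pos.2 hω)), sechTail]

theorem integral_deriv_soliton_sq (hμ : 0 < μ) (hω : 0 < ω) (ξ : ℝ) :
    ∫ x in Ioi (0 : ℝ), deriv (fun x => soliton μ ω (x + ξ)) x ^ 2 =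
      ((μ + 1) * ω) ^ (1 / μ) * ω * ((μ * Real.sqrt ω)⁻¹ *
        (sechTail (2 / μ) (μ * Real.sqrt ω * ξ) - sechTail (2 / μ + 2) (μ * Real.sqrt ω * ξ))) := by
  have hq : 0 < 2 / μ := by positivity
  have h : ∀ x, deriv (fun x => soliton μ ω (x + ξ)) x ^ 2 = ((μ + 1) * ω) ^ (1 / μ) * ω *
      (Real.cosh (μ * Real.sqrt ω * (x + ξ)) ^ (-(2 / μ)) -
        Real.cosh (μ * Real.sqrt ω * (x + ξ)) ^ (-(2 / μ + 2))) := fun x => by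
    rw [((hasDerivAt_soliton hμ (x + ξ)).comp_add_const x ξ).deriv, cosh_rpow_add_two,
      neg_sq, mul_pow, mul_pow, soliton_sq hμ hω, Real.sq_sqrt hω.le]
    ring
  simp_rw [h]
  rw [integral_const_mul, integral_Ioi_comp_mul_add
    (fun y => Real.cosh y ^ (-(2 / μ)) - Real.cosh y ^ (-(2 / μ + 2)))
    (mul_pos hμ (Real.sqrt_pos.2 hω)), integral_sub (integrableOn_cosh_rpow hq _)
    (integrableOn_cosh_rpow_add_two hq _)]
  simp only [sechTail]

/-- The energy of a piece of soliton on the halfline in terms of its frequency, its mass, and its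
value and slope at the origin. -/
theorem energy_soliton (hμ : 0 < μ) (hω : 0 < ω) (ξ : ℝ) :
    1 / 2 * (∫ x in Ioi (0 : ℝ), deriv (fun x => soliton μ ω (x + ξ)) x ^ 2) -
      1 / (2 * μ + 2) * (∫ x in Ioi (0 : ℝ), soliton μ ω (x + ξ) ^ (2 * μ + 2)) =
    ((μ - 2) * ω * (∫ x in Ioi (0 : ℝ), soliton μ ω (x + ξ) ^ 2) +
      2 * (Real.sqrt ω * Real.tanh (μ * Real.sqrt ω * ξ)) * soliton μ ω ξ ^ 2) /
        (2 * (μ + 2)) := by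
  rw [integral_deriv_soliton_sq hμ hω, integral_soliton_rpow hμ hω, integral_soliton_sq hμ hω,
    soliton_sq hμ hω]
  have h := sechTail_add_two (by positivity : 0 < 2 / μ) (μ * Real.sqrt ω * ξ)
  set J := sechTail (2 / μ) (μ * Real.sqrt ω * ξ)
  set J2 := sechTail (2 / μ + 2) (μ * Real.sqrt ω * ξ)
  set T := Real.tanh (μ * Real.sqrt ω * ξ)
  set C := Real.cosh (μ * Real.sqrt ω * ξ) ^ (-(2 / μ))
  have e : J2 = (2 * J - μ * (C * T)) / (μ + 2) := by
    field_simp at h ⊢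
    linarith
  rw [e]
  have hw : ω = Real.sqrt ω ^ 2 := (Real.sq_sqrt hω.le).symm
  generalize Real.sqrt ω = s at *
  subst hw
  field_simp
  ring

end Soliton

section Parameters

variable {μ m a : ℝ}

/-- The phase `u = μ √ω ξ` of the piece of soliton of mass `m` and vertex value `a`. -/
noncomputable def solPhase (μ m a : ℝ) : ℝ :=
  massCoordInv (2 / μ) ((2 - μ) * Real.log a + Real.log (Real.sqrt (μ + 1) / μ) - Real.log m)

/-- The frequency `ω(m, a)`. -/
noncomputable def solFreq (μ m a : ℝ) : ℝ :=
  a ^ (2 * μ) * Real.cosh (solPhase μ m a) ^ 2 / (μ + 1)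

/-- Minus the logarithmic derivative at the vertex of the piece of soliton of mass `m` and vertex
value `a`, that is, `√ω tanh (μ √ω ξ)`. -/
noncomputable def solSlope (μ m a : ℝ) : ℝ :=
  a ^ μ * Real.sinh (solPhase μ m a) / Real.sqrt (μ + 1)

/-- The energy on the halfline, without vertex term, of the piece of soliton of mass `m` and
vertex value `a`. -/
noncomputable def pieceEnergy (μ m a : ℝ) : ℝ :=
  ((μ - 2) * solFreq μ m a * m + 2 * solSlope μ m a * a ^ 2) / (2 * (μ + 2))

theorem solFreq_pos (hμ : 0 < μ) (ha : 0 < a) (m : ℝ) : 0 < solFreq μ m a := by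
  unfold solFreq
  positivity

theorem sqrt_solFreq (ha : 0 < a) (m : ℝ) :
    Real.sqrt (solFreq μ m a) = a ^ μ * Real.cosh (solPhase μ m a) / Real.sqrt (μ + 1) := by
  rw [solFreq, Real.sqrt_div (by positivity), mul_comm 2 μ, Real.rpow_mul ha.le, Real.rpow_two,
    ← mul_pow, Real.sqrt_sq (by positivity)]

theorem sqrt_solFreq_mul_tanh (ha : 0 < a) (m : ℝ) :
    Real.sqrt (solFreq μ m a) * Real.tanh (solPhase μ m a) = solSlope μ m a := by
  rw [sqrt_solFreq ha, solSlope, Real.tanh_eq_sinh_div_cosh]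
  field_simp

/-- With the frequency eliminated through the vertex value, the mass is a function of the vertex
value and of the phase `u`. -/
theorem soliton_mass_eq (hμ : 0 < μ) (ha : 0 < a) {ω u : ℝ}
    (hω : (μ + 1) * ω = a ^ (2 * μ) * Real.cosh u ^ 2) :
    ((μ + 1) * ω) ^ (1 / μ) * ((μ * Real.sqrt ω)⁻¹ * sechTail (2 / μ) u) =
      Real.exp ((2 - μ) * Real.log a + Real.log (Real.sqrt (μ + 1) / μ) -
        massCoord (2 / μ) u) := by
  have hc := Real.cosh_pos u
  have hJ := sechTail_pos (by positivity : 0 < 2 / μ) u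
  have hs : Real.sqrt ω = a ^ μ * Real.cosh u / Real.sqrt (μ + 1) := by
    rw [eq_div_of_mul_eq (by positivity) ((mul_comm ω _).trans hω), Real.sqrt_div (by positivity),
      mul_comm 2 μ, Real.rpow_mul ha.le, Real.rpow_two, ← mul_pow, Real.sqrt_sq (by positivity)]
  have h1 : ((μ + 1) * ω) ^ (1 / μ) =
      Real.exp (2 * Real.log a + 2 / μ * Real.log (Real.cosh u)) := by
    rw [hω, Real.rpow_def_of_pos (by positivity), Real.log_mul (by positivity) (by positivity),
      Real.log_rpow ha, Real.log_pow]
    congr 1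
    field_simp
    ring
  have h2 : a ^ μ = Real.exp (Real.log a * μ) := Real.rpow_def_of_pos ha μ
  rw [massCoord, hs, h1, h2]
  have e : (2 - μ) * Real.log a + Real.log (Real.sqrt (μ + 1) / μ) -
      -((2 / μ - 1) * Real.log (Real.cosh u) + Real.log (sechTail (2 / μ) u)) =
      (2 * Real.log a + 2 / μ * Real.log (Real.cosh u)) + Real.log (Real.sqrt (μ + 1) / μ) +
        Real.log (sechTail (2 / μ) u) - Real.log a * μ - Real.log (Real.cosh u) := by ring
  rw [e, Real.exp_sub, Real.exp_sub, Real.exp_add _ (Real.log (sechTail _ _)),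
    Real.exp_add _ (Real.log (Real.sqrt _ / _)), Real.exp_log (by positivity : 0 < Real.sqrt _ / _),
    Real.exp_log hJ, Real.exp_log hc]
  field_simp

/-- The pair `(ω, ξ)` is determined by `(m, a)`: the phase by inverting the mass coordinate, the
frequency by the vertex value. -/
theorem isSolitonParam_iff (hμ : 0 < μ) (hμ2 : μ < 2) (hm : 0 < m) (ha : 0 < a) (p : ℝ × ℝ) :
    IsSolitonParam μ m a p ↔
      p = (solFreq μ m a, solPhase μ m a / (μ * Real.sqrt (solFreq μ m a))) := by
  have hq : 1 < 2 / μ := by rw [lt_div_iff₀ hμ]; linarith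
  obtain ⟨ω, ξ⟩ := p
  have key : 0 < ω → ((∫ x in Ioi (0 : ℝ), soliton μ ω (x + ξ) ^ 2) = m ∧ soliton μ ω ξ = a ↔
      μ * Real.sqrt ω * ξ = solPhase μ m a ∧
        (μ + 1) * ω = a ^ (2 * μ) * Real.cosh (μ * Real.sqrt ω * ξ) ^ 2) := by
    intro hω
    rw [soliton_eq_iff hμ hω ha, integral_soliton_sq hμ hω]
    refine and_congr_left fun h => ?_
    rw [soliton_mass_eq hμ ha h, ← Real.exp_log hm, Real.exp_eq_exp, Real.exp_log hm, solPhase]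
    constructor
    · intro h2
      rw [← massCoordInv_massCoord hq (μ * Real.sqrt ω * ξ)]
      congr 1
      linarith
    · intro h2
      rw [h2, massCoord_massCoordInv hq]
      ring
  simp only [IsSolitonParam, Prod.mk.injEq]
  constructor
  · rintro ⟨hω, h⟩
    obtain ⟨h1, h2⟩ := (key hω).1 h
    have e : ω = solFreq μ m a := by
      rw [solFreq, ← h1, ← h2]; field_simp
    refine ⟨e, ?_⟩
    rw [← e, ← h1]
    field_simp
  · rintro ⟨rfl, rfl⟩
    have hω := solFreq_pos hμ ha m
    refine ⟨hω, (key hω).2 ?_⟩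
    have e : μ * Real.sqrt (solFreq μ m a) * (solPhase μ m a / (μ * Real.sqrt (solFreq μ m a))) =
        solPhase μ m a := by field_simp
    rw [e]
    refine ⟨rfl, ?_⟩
    rw [solFreq]
    field_simp

theorem existsUnique_isSolitonParam (hμ : 0 < μ) (hμ2 : μ < 2) (hm : 0 < m) (ha : 0 < a) :
    ∃! p, IsSolitonParam μ m a p :=
  ⟨_, (isSolitonParam_iff hμ hμ2 hm ha _).2 rfl, fun p hp =>
    (isSolitonParam_iff hμ hμ2 hm ha p).1 hp⟩

theorem isSolitonParam_solitonParam (hμ : 0 < μ) (hμ2 : μ < 2) (hm : 0 < m) (ha : 0 < a) :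
    IsSolitonParam μ m a (solitonParam μ m a) :=
  Classical.epsilon_spec (existsUnique_isSolitonParam hμ hμ2 hm ha).exists

theorem solitonPiece_zero (hμ : 0 < μ) (hμ2 : μ < 2) (hm : 0 < m) (ha : 0 < a) :
    solitonPiece μ m a 0 = a := by
  rw [solitonPiece, zero_add]
  exact (isSolitonParam_solitonParam hμ hμ2 hm ha).2.2

theorem energy_solitonPiece (hμ : 0 < μ) (hμ2 : μ < 2) (hm : 0 < m) (ha : 0 < a) :
    1 / 2 * (∫ x in Ioi (0 : ℝ), deriv (solitonPiece μ m a) x ^ 2) -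
      1 / (2 * μ + 2) * (∫ x in Ioi (0 : ℝ), solitonPiece μ m a x ^ (2 * μ + 2)) =
    pieceEnergy μ m a := by
  have h := isSolitonParam_solitonParam hμ hμ2 hm ha
  have hE := energy_soliton hμ h.1 (solitonParam μ m a).2
  have hp := (isSolitonParam_iff hμ hμ2 hm ha _).1 h
  rw [h.2.1, h.2.2] at hE
  have hf : solitonPiece μ m a = fun x =>
    soliton μ (solitonParam μ m a).1 (x + (solitonParam μ m a).2) := rfl
  rw [hf, hE, pieceEnergy, hp]
  have hs := Real.sqrt_pos.2 (solFreq_pos hμ ha m)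
  rw [show μ * Real.sqrt (solFreq μ m a) * (solPhase μ m a / (μ * Real.sqrt (solFreq μ m a))) =
    solPhase μ m a by field_simp, sqrt_solFreq_mul_tanh ha]

end Parameters

/-! ### Derivatives of the soliton parameters and of the energy of a piece -/

section Derivatives

variable {μ t m' a' : ℝ} {m a : ℝ → ℝ}

theorem massCoord_solPhase (hμ : 0 < μ) (hμ2 : μ < 2) (m a : ℝ) :
    massCoord (2 / μ) (solPhase μ m a) =
      (2 - μ) * Real.log a + Real.log (Real.sqrt (μ + 1) / μ) - Real.log m :=
  massCoord_massCoordInv (by rw [lt_div_iff₀ hμ]; linarith) _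

/-- The derivative of the mass coordinate, with the tail integral expressed through the mass. -/
theorem mass_mul_massCoordDeriv (hμ : 0 < μ) (hμ2 : μ < 2) {m a : ℝ} (hm : 0 < m) (ha : 0 < a) :
    m * massCoordDeriv (2 / μ) (solPhase μ m a) =
      Real.sqrt (μ + 1) / μ * a ^ 2 / (a ^ μ * Real.cosh (solPhase μ m a)) -
        (2 / μ - 1) * m * Real.tanh (solPhase μ m a) := by
  have h := massCoord_solPhase hμ hμ2 m a
  set u := solPhase μ m a
  have hc := Real.cosh_pos u
  have hJ := sechTail_pos (by positivity : 0 < 2 / μ) u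
  have e : m = Real.sqrt (μ + 1) / μ * a ^ 2 / (a ^ μ * Real.cosh u) *
      (Real.cosh u ^ (2 / μ) * sechTail (2 / μ) u) := by
    rw [← Real.exp_log hm]
    refine Eq.trans ?_ (Real.exp_log (by positivity : 0 < Real.sqrt (μ + 1) / μ * a ^ 2 /
      (a ^ μ * Real.cosh u) * (Real.cosh u ^ (2 / μ) * sechTail (2 / μ) u)))
    rw [Real.log_mul (by positivity) (by positivity), Real.log_div (by positivity) (by positivity),
      Real.log_mul (x := Real.sqrt (μ + 1) / μ) (by positivity) (by positivity),
      Real.log_mul (x := a ^ μ) (by positivity) hc.ne',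
      Real.log_mul (y := sechTail (2 / μ) u) (by positivity) hJ.ne', Real.log_pow,
      Real.log_rpow ha, Real.log_rpow hc]
    rw [massCoord] at h
    congr 1
    linarith
  rw [massCoordDeriv, mul_sub, Real.rpow_neg hc.le]
  congr 1
  · conv_lhs => rw [e]
    field_simp
  · ring

theorem hasDerivAt_solPhase (hμ : 0 < μ) (hμ2 : μ < 2) (hm : HasDerivAt m m' t)
    (ha : HasDerivAt a a' t) (hm0 : 0 < m t) (ha0 : 0 < a t) :
    HasDerivAt (fun t => solPhase μ (m t) (a t))
      (((2 - μ) * (a' / a t) - m' / m t) / massCoordDeriv (2 / μ) (solPhase μ (m t) (a t))) t := by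
  have h1 := (((ha.log ha0.ne').const_mul (2 - μ)).add_const
    (Real.log (Real.sqrt (μ + 1) / μ))).sub (hm.log hm0.ne')
  have h2 := (hasDerivAt_massCoordInv (by rw [lt_div_iff₀ hμ]; linarith : 1 < 2 / μ) _).comp t h1
  exact h2.congr_deriv (div_eq_inv_mul _ _).symm

theorem hasDerivAt_solFreq (hμ : 0 < μ) (hμ2 : μ < 2) (hm : HasDerivAt m m' t)
    (ha : HasDerivAt a a' t) (hm0 : 0 < m t) (ha0 : 0 < a t) :
    HasDerivAt (fun t => solFreq μ (m t) (a t))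
      (solFreq μ (m t) (a t) * (2 * μ * (a' / a t) + 2 * Real.tanh (solPhase μ (m t) (a t)) *
        (((2 - μ) * (a' / a t) - m' / m t) /
          massCoordDeriv (2 / μ) (solPhase μ (m t) (a t))))) t := by
  have hu := hasDerivAt_solPhase hμ hμ2 hm ha hm0 ha0
  have h := ((ha.rpow_const (p := 2 * μ) (Or.inl ha0.ne')).mul (hu.cosh.pow 2)).div_const (μ + 1)
  refine h.congr_deriv ?_
  rw [solFreq, Real.rpow_sub_one ha0.ne', Real.tanh_eq_sinh_div_cosh]
  field_simp
  simp
  ring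

theorem hasDerivAt_solSlope (hμ : 0 < μ) (hμ2 : μ < 2) (hm : HasDerivAt m m' t)
    (ha : HasDerivAt a a' t) (hm0 : 0 < m t) (ha0 : 0 < a t) :
    HasDerivAt (fun t => solSlope μ (m t) (a t))
      (solSlope μ (m t) (a t) * (μ * (a' / a t)) + Real.sqrt (solFreq μ (m t) (a t)) *
        (((2 - μ) * (a' / a t) - m' / m t) /
          massCoordDeriv (2 / μ) (solPhase μ (m t) (a t)))) t := by
  have hu := hasDerivAt_solPhase hμ hμ2 hm ha hm0 ha0
  have h := ((ha.rpow_const (p := μ) (Or.inl ha0.ne')).mul hu.sinh).div_const (Real.sqrt (μ + 1))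
  refine h.congr_deriv ?_
  rw [sqrt_solFreq ha0, solSlope, Real.rpow_sub_one ha0.ne']
  field_simp

/-- The differential of the energy of a piece is `-ω/2 dm - φ'(0) da`: the piece is a critical
point of energy plus `ω/2` times mass among functions with a given vertex value. -/
theorem hasDerivAt_pieceEnergy (hμ : 0 < μ) (hμ2 : μ < 2) (hm : HasDerivAt m m' t)
    (ha : HasDerivAt a a' t) (hm0 : 0 < m t) (ha0 : 0 < a t) :
    HasDerivAt (fun t => pieceEnergy μ (m t) (a t))
      (-(solFreq μ (m t) (a t)) / 2 * m' + solSlope μ (m t) (a t) * a t * a') t := by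
  have hω := hasDerivAt_solFreq hμ hμ2 hm ha hm0 ha0
  have hs := hasDerivAt_solSlope hμ hμ2 hm ha hm0 ha0
  have h := ((((hω.const_mul (μ - 2)).mul hm).add
    ((hs.const_mul 2).mul (ha.pow 2)))).div_const (2 * (μ + 2))
  refine h.congr_deriv ?_
  have hD := mass_mul_massCoordDeriv hμ hμ2 hm0 ha0
  have hDpos := massCoordDeriv_pos (by rw [lt_div_iff₀ hμ]; linarith : 1 < 2 / μ)
    (solPhase μ (m t) (a t))
  set u := solPhase μ (m t) (a t) with hu
  set D := massCoordDeriv (2 / μ) u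
  set u' := ((2 - μ) * (a' / a t) - m' / m t) / D
  have hω' : solFreq μ (m t) (a t) =
      (a t ^ μ * Real.cosh u / Real.sqrt (μ + 1)) ^ 2 := by
    rw [hu, ← sqrt_solFreq ha0, Real.sq_sqrt (solFreq_pos hμ ha0 _).le]
  have hsq : Real.sqrt (solFreq μ (m t) (a t)) =
      a t ^ μ * Real.cosh u / Real.sqrt (μ + 1) := sqrt_solFreq ha0 _
  -- the coefficient of the derivative of the phase is proportional to that of the mass coordinate
  have key : (μ - 2) * (2 * solFreq μ (m t) (a t) * Real.tanh u) * m t +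
      2 * (a t ^ μ * Real.cosh u / Real.sqrt (μ + 1)) * a t ^ 2 =
        2 * μ * solFreq μ (m t) (a t) * (m t * D) := by
    rw [hD, hω']
    field_simp
    ring
  have key2 : m t * D * u' = (2 - μ) * m t * (a' / a t) - m' := by
    rw [mul_assoc, mul_comm D, div_mul_cancel₀ _ hDpos.ne']
    field_simp
  rw [hsq]
  rw [div_eq_iff (by positivity)]
  have hr : a' = a' / a t * a t := by field_simp
  simp only [Pi.pow_apply]
  generalize a' / a t = r at *
  subst hr
  linear_combination u' * key + 2 * μ * solFreq μ (m t) (a t) * key2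

/-- The derivative of the differential of the energy of a piece, applied to `(x, y)`. -/
theorem hasDerivAt_pieceEnergy_differential (hμ : 0 < μ) (hμ2 : μ < 2) (hm : HasDerivAt m m' t)
    (ha : HasDerivAt a a' t) (hm0 : 0 < m t) (ha0 : 0 < a t) (x y : ℝ) :
    HasDerivAt (fun t => -(solFreq μ (m t) (a t)) / 2 * x + solSlope μ (m t) (a t) * a t * y)
      (-(solFreq μ (m t) (a t) * (2 * μ * (a' / a t) + 2 * Real.tanh (solPhase μ (m t) (a t)) *
        (((2 - μ) * (a' / a t) - m' / m t) /
          massCoordDeriv (2 / μ) (solPhase μ (m t) (a t))))) / 2 * x +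
      ((solSlope μ (m t) (a t) * (μ * (a' / a t)) + Real.sqrt (solFreq μ (m t) (a t)) *
        (((2 - μ) * (a' / a t) - m' / m t) /
          massCoordDeriv (2 / μ) (solPhase μ (m t) (a t)))) * a t +
        solSlope μ (m t) (a t) * a') * y) t :=
  (((hasDerivAt_solFreq hμ hμ2 hm ha hm0 ha0).fun_neg.div_const 2).mul_const x).add
    (((hasDerivAt_solSlope hμ hμ2 hm ha hm0 ha0).mul ha).mul_const y)

end Derivatives

section Smooth

variable {E : Type*} [NormedAddCommGroup E] [NormedSpace ℝ E] {μ : ℝ} {f g : E → ℝ} {x : E}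

theorem contDiffAt_solPhase (hμ : 0 < μ) (hμ2 : μ < 2) (hf : ContDiffAt ℝ 2 f x)
    (hg : ContDiffAt ℝ 2 g x) (hf0 : 0 < f x) (hg0 : 0 < g x) :
    ContDiffAt ℝ 2 (fun p => solPhase μ (f p) (g p)) x := by
  have h : ContDiff ℝ 2 (massCoordInv (2 / μ)) :=
    (contDiff_massCoordInv (by rw [lt_div_iff₀ hμ]; linarith)).of_le (by norm_cast)
  exact h.contDiffAt.comp x (((contDiffAt_const.mul (hg.log hg0.ne')).add contDiffAt_const).sub
    (hf.log hf0.ne'))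

theorem contDiffAt_pieceEnergy (hμ : 0 < μ) (hμ2 : μ < 2) (hf : ContDiffAt ℝ 2 f x)
    (hg : ContDiffAt ℝ 2 g x) (hf0 : 0 < f x) (hg0 : 0 < g x) :
    ContDiffAt ℝ 2 (fun p => pieceEnergy μ (f p) (g p)) x := by
  have hu := contDiffAt_solPhase hμ hμ2 hf hg hf0 hg0
  have hω : ContDiffAt ℝ 2 (fun p => solFreq μ (f p) (g p)) x :=
    ((hg.rpow_const_of_ne hg0.ne').mul (hu.cosh.pow 2)).div_const _
  have hs : ContDiffAt ℝ 2 (fun p => solSlope μ (f p) (g p)) x :=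
    ((hg.rpow_const_of_ne hg0.ne').mul hu.sinh).div_const _
  exact (((contDiffAt_const.mul hω).mul hf).add
    ((contDiffAt_const.mul hs).mul (hg.pow 2))).div_const _

end Smooth

/-! ### The second derivative test -/

section SecondDerivativeTest

variable {E : Type*} [NormedAddCommGroup E] [NormedSpace ℝ E]

theorem hasDerivAt_line (x v : E) (t : ℝ) : HasDerivAt (fun t : ℝ => x + t • v) v t := by
  simpa using ((hasDerivAt_id t).smul_const v).const_add x

theorem hasDerivAt_fderiv_line {f : E → ℝ} {x : E} (hf : ContDiffAt ℝ 2 f x) (v : E) :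
    HasDerivAt (fun t : ℝ => fderiv ℝ f (x + t • v) v) (fderiv ℝ (fderiv ℝ f) x v v) 0 := by
  have hd : HasFDerivAt (fderiv ℝ f) (fderiv ℝ (fderiv ℝ f) x) (x + (0 : ℝ) • v) := by
    rw [zero_smul, add_zero]
    exact ((hf.fderiv_right (m := 1) (by norm_num)).differentiableAt (by simp)).hasFDerivAt
  have h : HasDerivAt (fun t : ℝ => fderiv ℝ f (x + t • v)) (fderiv ℝ (fderiv ℝ f) x v) 0 :=
    hd.comp_hasDerivAt 0 (hasDerivAt_line x v 0)
  simpa using h.clm_apply (hasDerivAt_const 0 v)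

variable [FiniteDimensional ℝ E]

theorem exists_pos_mul_norm_sq_le {B : E →L[ℝ] E →L[ℝ] ℝ} (hB : ∀ v, v ≠ 0 → 0 < B v v) :
    ∃ c > 0, ∀ v, c * ‖v‖ ^ 2 ≤ B v v := by
  -- the unit sphere, on which the form attains its minimum, is empty in the trivial space
  rcases subsingleton_or_nontrivial E with h | h
  · exact ⟨1, one_pos, fun v => by simp [Subsingleton.elim v 0]⟩
  have hcont : Continuous fun v => B v v := by fun_prop
  obtain ⟨w, hw, hmin⟩ := (isCompact_sphere (0 : E) 1).exists_isMinOn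
    (NormedSpace.sphere_nonempty.2 zero_le_one) hcont.continuousOn
  have hw0 : w ≠ 0 := by
    rintro rfl
    simp at hw
  refine ⟨B w w, hB w hw0, fun v => ?_⟩
  rcases eq_or_ne v 0 with rfl | hv
  · simp
  have hn : 0 < ‖v‖ := norm_pos_iff.2 hv
  have h1 : B w w ≤ B (‖v‖⁻¹ • v) (‖v‖⁻¹ • v) := hmin (by simp [norm_smul, hn.ne'])
  simp only [map_smul, FunLike.coe_smul, Pi.smul_apply, smul_eq_mul] at h1
  calc B w w * ‖v‖ ^ 2 ≤ ‖v‖⁻¹ * (‖v‖⁻¹ * B v v) * ‖v‖ ^ 2 := by gcongr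
    _ = B v v := by field_simp

/-- A critical point of a `C²` function with positive definite Hessian is a strict local minimum:
on short segments from it the directional derivative is positive. -/
theorem eventually_lt_of_fderiv_fderiv_pos {f : E → ℝ} {x : E} (hf : ContDiffAt ℝ 2 f x)
    (hx : fderiv ℝ f x = 0) (hpos : ∀ v, v ≠ 0 → 0 < fderiv ℝ (fderiv ℝ f) x v v) :
    ∀ᶠ y in 𝓝[≠] x, f x < f y := by
  obtain ⟨c, hc, hB⟩ := exists_pos_mul_norm_sq_le hpos
  have hd : ∀ᶠ y in 𝓝 x, DifferentiableAt ℝ f y :=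
    (hf.eventually (by simp)).mono fun y hy => hy.differentiableAt (by simp)
  have hD : HasFDerivAt (fderiv ℝ f) (fderiv ℝ (fderiv ℝ f) x) x :=
    ((hf.fderiv_right (m := 1) (by norm_num)).differentiableAt (by simp)).hasFDerivAt
  -- half of the lower bound of the Hessian absorbs the linearization error of the gradient
  have ho := hD.isLittleO.def (half_pos hc)
  obtain ⟨r, hr, hball⟩ := Metric.eventually_nhds_iff_ball.1 (hd.and ho)
  refine eventually_nhdsWithin_iff.2 ?_
  filter_upwards [Metric.ball_mem_nhds x hr] with y hy hyx
  set v := y - x with hv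
  have hv0 : 0 < ‖v‖ := norm_pos_iff.2 (sub_ne_zero.2 hyx)
  have hmem : ∀ t ∈ Icc (0 : ℝ) 1, x + t • v ∈ Metric.ball x r := fun t ht => by
    rw [mem_ball_iff_norm, add_sub_cancel_left, norm_smul, Real.norm_of_nonneg ht.1]
    rw [mem_ball_iff_norm] at hy
    exact (mul_le_of_le_one_left (norm_nonneg _) ht.2).trans_lt hy
  have hderiv : ∀ t ∈ Icc (0 : ℝ) 1,
      HasDerivAt (fun t : ℝ => f (x + t • v)) (fderiv ℝ f (x + t • v) v) t := fun t ht =>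
    (hball _ (hmem t ht)).1.hasFDerivAt.comp_hasDerivAt t (hasDerivAt_line x v t)
  have hmono : StrictMonoOn (fun t : ℝ => f (x + t • v)) (Icc 0 1) := by
    refine strictMonoOn_of_deriv_pos (convex_Icc 0 1)
      (fun t ht => (hderiv t ht).continuousAt.continuousWithinAt) fun t ht => ?_
    rw [interior_Icc] at ht
    have ht' := Ioo_subset_Icc_self ht
    rw [(hderiv t ht').deriv]
    have h2 := (hball _ (hmem t ht')).2
    rw [hx, sub_zero, add_sub_cancel_left] at h2
    have h3 := (ContinuousLinearMap.le_opNorm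
      (fderiv ℝ f (x + t • v) - fderiv ℝ (fderiv ℝ f) x (t • v)) v).trans
      (mul_le_mul_of_nonneg_right h2 (norm_nonneg v))
    rw [norm_smul, Real.norm_of_nonneg ht'.1] at h3
    have h4 := (abs_le.1 ((Real.norm_eq_abs _).symm.le.trans h3)).1
    simp only [map_smul, FunLike.coe_sub, FunLike.coe_smul, Pi.sub_apply, Pi.smul_apply,
      smul_eq_mul] at h4
    have h5 := mul_le_mul_of_nonneg_left (hB v) ht'.1
    have h6 : 0 < t * (c / 2 * ‖v‖ ^ 2) := mul_pos ht.1 (by positivity)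
    nlinarith
  have := hmono (left_mem_Icc.2 zero_le_one) (right_mem_Icc.2 zero_le_one) one_pos
  simpa [hv] using this

end SecondDerivativeTest

/-! ### The family of symmetric bound states -/

section SymState

variable {N : ℕ} {μ α ω : ℝ}

theorem lt_natCast_mul_sqrt (hN : 0 < N) (hω : α ^ 2 / (N : ℝ) ^ 2 < ω) :
    α < N * Real.sqrt ω := by
  have hN' : (0 : ℝ) < N := by exact_mod_cast hN
  rw [← div_pow] at hω
  have := Real.lt_sqrt_of_sq_lt hω
  rw [div_lt_iff₀ hN'] at this
  linarith

theorem symShift_arg_mem (hN : 0 < N) (hα : 0 < α) (hω : α ^ 2 / (N : ℝ) ^ 2 < ω) :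
    α / (N * Real.sqrt ω) ∈ Ioo (0 : ℝ) 1 := by
  have h := lt_natCast_mul_sqrt hN hω
  exact ⟨div_pos hα (hα.trans h), (div_lt_one (hα.trans h)).2 h⟩

theorem freq_pos_of_lt (hω : α ^ 2 / (N : ℝ) ^ 2 < ω) : 0 < ω :=
  lt_of_le_of_lt (by positivity) hω

theorem starMass_symState (N : ℕ) (μ α ω : ℝ) : starMass (symState N μ α ω) =
    N * ∫ x in Ioi (0 : ℝ), soliton μ ω (x + symShift N μ α ω) ^ 2 := by
  simp [starMass, symState]

theorem mul_symShift (hμ : 0 < μ) (hω : 0 < ω) :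
    μ * Real.sqrt ω * symShift N μ α ω = Real.artanh (α / (N * Real.sqrt ω)) := by
  rw [symShift]
  field_simp

theorem starMass_symState_eq (hμ : 0 < μ) (hω : 0 < ω) : starMass (symState N μ α ω) =
    N * (μ + 1) ^ (1 / μ) / μ * (Real.sqrt ω ^ (2 / μ - 1) *
      sechTail (2 / μ) (Real.artanh (α / (N * Real.sqrt ω)))) := by
  have hs := Real.sqrt_pos.2 hω
  rw [starMass_symState, integral_soliton_sq hμ hω, mul_symShift hμ hω,
    Real.mul_rpow (by positivity) hω.le, Real.rpow_sub_one hs.ne']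
  have e : ω ^ (1 / μ) = Real.sqrt ω ^ (2 / μ) := by
    conv_lhs => rw [← Real.sq_sqrt hω.le, ← Real.rpow_natCast_mul hs.le]
    congr 1
    ring
  rw [e]
  field_simp

theorem starMass_symState_strictMonoOn (hN : 0 < N) (hμ : 0 < μ) (hμ2 : μ < 2) (hα : 0 < α) :
    StrictMonoOn (fun ω => starMass (symState N μ α ω)) (Ioi (α ^ 2 / (N : ℝ) ^ 2)) := by
  intro ω₁ h₁ ω₂ h₂ h
  have hq : 1 < 2 / μ := by rw [lt_div_iff₀ hμ]; linarith
  have hω₁ : 0 < ω₁ := freq_pos_of_lt h₁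
  have hω₂ : 0 < ω₂ := freq_pos_of_lt h₂
  have hs₁ := Real.sqrt_pos.2 hω₁
  have hs : Real.sqrt ω₁ < Real.sqrt ω₂ := Real.sqrt_lt_sqrt hω₁.le h
  obtain ⟨h0, -⟩ := symShift_arg_mem hN hα h₂
  obtain ⟨-, h1⟩ := symShift_arg_mem hN hα h₁
  have hlt : α / (N * Real.sqrt ω₂) < α / (N * Real.sqrt ω₁) := by gcongr
  have hJ := sechTail_strictAnti (by linarith : 0 < 2 / μ)
    (Real.artanh_lt_artanh (by linarith) h1 hlt)
  have hJ₁ := sechTail_pos (by linarith : 0 < 2 / μ) (Real.artanh (α / (N * Real.sqrt ω₁)))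
  simp only [starMass_symState_eq hμ hω₁, starMass_symState_eq hμ hω₂]
  gcongr

/-- The mass of the symmetric state takes every positive value: parametrized by the phase `u > 0`,
with `√ω = α / (N tanh u)`, it tends to infinity as `u → 0` and to `0` as `u → ∞`. -/
theorem exists_starMass_symState_eq (hN : 0 < N) (hμ : 0 < μ) (hμ2 : μ < 2) (hα : 0 < α) {M : ℝ}
    (hM : 0 < M) : ∃ ω, α ^ 2 / (N : ℝ) ^ 2 < ω ∧ starMass (symState N μ α ω) = M := by
  have hN' : (0 : ℝ) < N := by exact_mod_cast hN
  have hq : 1 < 2 / μ := by rw [lt_div_iff₀ hμ]; linarith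
  have hq0 : 0 < 2 / μ := by linarith
  set C : ℝ := N * (μ + 1) ^ (1 / μ) / μ
  have hC0 : 0 < C := by positivity
  set h : ℝ → ℝ := fun u =>
    C * ((α / (N * Real.tanh u)) ^ (2 / μ - 1) * sechTail (2 / μ) u)
  have htc : Continuous Real.tanh :=
    continuous_iff_continuousAt.2 fun x => (hasDerivAt_tanh x).continuousAt
  have hJc := (contDiff_sechTail hq0).continuous
  have hcont : ContinuousOn h (Ioi 0) := by
    refine continuousOn_const.mul (ContinuousOn.mul (ContinuousOn.rpow_const ?_ ?_)
      hJc.continuousOn)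
    · exact continuousOn_const.div (continuousOn_const.mul htc.continuousOn)
        fun u hu => (mul_pos hN' (tanh_pos hu)).ne'
    · exact fun u hu => Or.inl (div_pos hα (mul_pos hN' (tanh_pos hu))).ne'
  have htop : Tendsto h (𝓝[>] 0) atTop := by
    have h1 : Tendsto (fun u => N * Real.tanh u) (𝓝[>] 0) (𝓝[>] 0) := by
      refine tendsto_nhdsWithin_iff.2 ⟨?_, ?_⟩
      · have : Tendsto (fun u => N * Real.tanh u) (𝓝 0) (𝓝 (N * Real.tanh 0)) :=
          (continuous_const.mul htc).tendsto 0
        rw [Real.tanh_zero, mul_zero] at this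
        exact this.mono_left nhdsWithin_le_nhds
      · filter_upwards [self_mem_nhdsWithin] with u hu using mul_pos hN' (tanh_pos hu)
    have h2 : Tendsto (fun u => (α / (N * Real.tanh u)) ^ (2 / μ - 1)) (𝓝[>] 0) atTop := by
      refine (tendsto_rpow_atTop (by linarith)).comp ?_
      simp_rw [div_eq_mul_inv]
      exact (tendsto_inv_nhdsGT_zero.comp h1).const_mul_atTop hα
    have h3 : Tendsto (sechTail (2 / μ)) (𝓝[>] 0) (𝓝 (sechTail (2 / μ) 0)) :=
      (hJc.tendsto 0).mono_left nhdsWithin_le_nhds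
    exact (h2.atTop_mul_pos (sechTail_pos hq0 0) h3).const_mul_atTop hC0
  have hzero : Tendsto h atTop (𝓝 0) := by
    have hb : Tendsto (fun u => C * ((α / (N * Real.tanh 1)) ^ (2 / μ - 1) * sechTail (2 / μ) u))
        atTop (𝓝 0) := by
      simpa using ((tendsto_sechTail_atTop hq0).const_mul
        ((α / (N * Real.tanh 1)) ^ (2 / μ - 1))).const_mul C
    refine squeeze_zero' ?_ ?_ hb
    · filter_upwards [eventually_gt_atTop 0] with u hu
      have := tanh_pos hu
      have := sechTail_pos hq0 u
      positivity
    · filter_upwards [eventually_ge_atTop 1] with u hu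
      have h1 := tanh_pos one_pos
      have h2 := sechTail_pos hq0 u
      have hmono : StrictMono Real.tanh := strictMono_of_hasDerivAt_pos hasDerivAt_tanh fun x => by
        linarith [Real.tanh_sq_lt_one x]
      have h3 := hmono.monotone hu
      have h5 := h1.trans_le h3
      simp only [h]
      gcongr
  obtain ⟨u₁, hu₁, hu₁0⟩ := ((htop.eventually_ge_atTop M).and self_mem_nhdsWithin).exists
  obtain ⟨u₂, hu₂, hu₂0⟩ := ((hzero.eventually_le_const hM).and (eventually_gt_atTop 0)).exists
  obtain ⟨u, hu, hhu⟩ := isPreconnected_Ioi.intermediate_value hu₂0 hu₁0 hcont ⟨hu₂, hu₁⟩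
  have ht := tanh_pos hu
  have hs : Real.sqrt ((α / (N * Real.tanh u)) ^ 2) = α / (N * Real.tanh u) :=
    Real.sqrt_sq (by positivity)
  refine ⟨(α / (N * Real.tanh u)) ^ 2, ?_, ?_⟩
  · rw [← div_pow]
    have := Real.tanh_lt_one u
    gcongr
    exact mul_lt_of_lt_one_right hN' this
  · rw [starMass_symState_eq hμ (by positivity), hs, ← hhu]
    rw [show α / (N * (α / (N * Real.tanh u))) = Real.tanh u by field_simp, Real.artanh_tanh]

theorem existsUnique_starMass_symState_eq (hN : 0 < N) (hμ : 0 < μ) (hμ2 : μ < 2) (hα : 0 < α)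
    {M : ℝ} (hM : 0 < M) : ∃! ω, α ^ 2 / (N : ℝ) ^ 2 < ω ∧ starMass (symState N μ α ω) = M := by
  obtain ⟨ω, h1, h2⟩ := exists_starMass_symState_eq hN hμ hμ2 hα hM
  exact ⟨ω, ⟨h1, h2⟩, fun ω' h' => (starMass_symState_strictMonoOn hN hμ hμ2 hα).injOn h'.1 h1
    (h'.2.trans h2.symm)⟩

/-- On each edge `Ψ_ω` is the piece of soliton of mass `M / N` and vertex value `φ_ω(ζ)`. -/
theorem isSolitonParam_symShift (hN : 0 < N) {M : ℝ} (hω : 0 < ω)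
    (h : starMass (symState N μ α ω) = M) :
    IsSolitonParam μ (M / N) (soliton μ ω (symShift N μ α ω)) (ω, symShift N μ α ω) := by
  refine ⟨hω, ?_, rfl⟩
  rw [starMass_symState] at h
  rw [← h]
  field_simp

end SymState

/-! ### Edge masses -/

section EdgeMass

variable {N : ℕ}

theorem edgeMass_of_lt (M : ℝ) (m : Fin (N - 1) → ℝ) (i : Fin (N - 1)) (h : (i : ℕ) < N) :
    edgeMass N M m ⟨i, h⟩ = m i := by
  simp [edgeMass]

theorem sum_edgeMass [NeZero N] (M : ℝ) (m : Fin (N - 1) → ℝ) : ∑ i, edgeMass N M m i = M := by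
  obtain ⟨n, rfl⟩ := Nat.exists_eq_succ_of_ne_zero (NeZero.ne N)
  rw [Fin.sum_univ_castSucc]
  simp [edgeMass]

theorem edgeMass_add_smul (M : ℝ) (m v : Fin (N - 1) → ℝ) (t : ℝ) (i : Fin N) :
    edgeMass N M (m + t • v) i = edgeMass N M m i + t * edgeMass N 0 v i := by
  unfold edgeMass
  split_ifs
  · simp
  · simp [Finset.sum_add_distrib, ← Finset.mul_sum]
    ring

theorem hasDerivAt_edgeMass_line (M : ℝ) (m v : Fin (N - 1) → ℝ) (i : Fin N) (t : ℝ) :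
    HasDerivAt (fun t : ℝ => edgeMass N M (m + t • v) i) (edgeMass N 0 v i) t := by
  simp only [edgeMass_add_smul]
  simpa using ((hasDerivAt_id t).mul_const (edgeMass N 0 v i)).const_add (edgeMass N M m i)

theorem contDiff_edgeMass (M : ℝ) (i : Fin N) :
    ContDiff ℝ 2 (fun P : (Fin (N - 1) → ℝ) × ℝ => edgeMass N M P.1 i) := by
  unfold edgeMass
  split_ifs <;> fun_prop

theorem edgeMass_pos {M : ℝ} {P : (Fin (N - 1) → ℝ) × ℝ} (hP : P ∈ reducedDomain N M) (i : Fin N) :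
    0 < edgeMass N M P.1 i := by
  unfold edgeMass
  split_ifs
  · exact hP.1 _
  · linarith [hP.2.1]

theorem edgeMass_const [NeZero N] (M : ℝ) (i : Fin N) :
    edgeMass N M (fun _ => M / N) i = M / N := by
  have hN : (N : ℝ) ≠ 0 := by exact_mod_cast NeZero.ne N
  unfold edgeMass
  split_ifs
  · rfl
  · rw [Finset.sum_const, Finset.card_univ, Fintype.card_fin, nsmul_eq_mul,
      Nat.cast_pred (NeZero.pos N)]
    field_simp
    ring

theorem isOpen_reducedDomain (M : ℝ) : IsOpen (reducedDomain N M) := by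
  have h1 : IsOpen {P : (Fin (N - 1) → ℝ) × ℝ | ∀ i, 0 < P.1 i} := by
    simp only [ofPred_forall]
    exact isOpen_iInter_of_finite fun i => isOpen_lt continuous_const (by fun_prop)
  have h2 : IsOpen {P : (Fin (N - 1) → ℝ) × ℝ | ∑ i, P.1 i < M} :=
    isOpen_lt (by fun_prop) continuous_const
  have h3 : IsOpen {P : (Fin (N - 1) → ℝ) × ℝ | 0 < P.2} :=
    isOpen_lt continuous_const (by fun_prop)
  exact h1.inter (h2.inter h3)

end EdgeMass

/-! ### The reduced energy -/

section ReducedEnergy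

variable {N : ℕ} [NeZero N] {μ α M : ℝ}

theorem norm_deriv_ofReal_comp (f : ℝ → ℝ) (x : ℝ) (hf : DifferentiableAt ℝ f x) :
    ‖deriv (fun y => ((f y : ℝ) : ℂ)) x‖ = |deriv f x| := by
  rw [hf.hasDerivAt.ofReal_comp.deriv, Complex.norm_real, Real.norm_eq_abs]

/-- On its domain the reduced energy is a sum of explicit functions of the edge masses and the
vertex value. -/
theorem reducedEnergy_eq (hμ : 0 < μ) (hμ2 : μ < 2) {P : (Fin (N - 1) → ℝ) × ℝ}
    (hP : P ∈ reducedDomain N M) :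
    reducedEnergy N μ α M P =
      ∑ i, pieceEnergy μ (edgeMass N M P.1 i) P.2 - α / 2 * P.2 ^ 2 := by
  have hm := edgeMass_pos hP
  have ha : 0 < P.2 := hP.2.2
  have hd : ∀ m x, DifferentiableAt ℝ (solitonPiece μ m P.2) x := fun m x =>
    ((hasDerivAt_soliton hμ _).comp_add_const x _).differentiableAt
  have hpos : ∀ i x, 0 ≤ solitonPiece μ (edgeMass N M P.1 i) P.2 x := fun i x =>
    (soliton_pos hμ (isSolitonParam_solitonParam hμ hμ2 (hm i) ha).1 _).le
  have hdm : ∀ i x, ‖deriv (multiSoliton N μ M P i) x‖ =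
      |deriv (solitonPiece μ (edgeMass N M P.1 i) P.2) x| := fun i x =>
    norm_deriv_ofReal_comp _ _ (hd _ _)
  simp only [reducedEnergy, starEnergy, hdm, multiSoliton, Complex.norm_real, sq_abs,
    Real.norm_eq_abs, abs_of_nonneg (hpos _ _), solitonPiece_zero hμ hμ2 (hm _) ha]
  rw [Finset.mul_sum, Finset.mul_sum, ← Finset.sum_sub_distrib]
  congr 1
  exact Finset.sum_congr rfl fun i _ => energy_solitonPiece hμ hμ2 (hm i) ha

theorem contDiffAt_reducedEnergy (hμ : 0 < μ) (hμ2 : μ < 2) {P : (Fin (N - 1) → ℝ) × ℝ}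
    (hP : P ∈ reducedDomain N M) : ContDiffAt ℝ 2 (reducedEnergy N μ α M) P := by
  have h : ContDiffAt ℝ 2 (fun P : (Fin (N - 1) → ℝ) × ℝ =>
      ∑ i, pieceEnergy μ (edgeMass N M P.1 i) P.2 - α / 2 * P.2 ^ 2) P := by
    refine ContDiffAt.sub (ContDiffAt.sum fun i _ => ?_) (by fun_prop)
    exact contDiffAt_pieceEnergy hμ hμ2 (contDiff_edgeMass M i).contDiffAt contDiffAt_snd
      (edgeMass_pos hP i) hP.2.2
  refine h.congr_of_eventuallyEq ?_
  filter_upwards [(isOpen_reducedDomain M).mem_nhds hP] with Q hQ using reducedEnergy_eq hμ hμ2 hQ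

theorem fderiv_reducedEnergy (hμ : 0 < μ) (hμ2 : μ < 2) {P : (Fin (N - 1) → ℝ) × ℝ}
    (hP : P ∈ reducedDomain N M) (v : (Fin (N - 1) → ℝ) × ℝ) :
    fderiv ℝ (reducedEnergy N μ α M) P v =
      ∑ i, (-(solFreq μ (edgeMass N M P.1 i) P.2) / 2 * edgeMass N 0 v.1 i +
        solSlope μ (edgeMass N M P.1 i) P.2 * P.2 * v.2) - α * P.2 * v.2 := by
  have hl := hasDerivAt_line P v 0
  have h1 : HasDerivAt (fun t : ℝ => reducedEnergy N μ α M (P + t • v))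
      (fderiv ℝ (reducedEnergy N μ α M) P v) 0 := by
    have hd : HasFDerivAt (reducedEnergy N μ α M) (fderiv ℝ (reducedEnergy N μ α M) P)
        (P + (0 : ℝ) • v) := by
      rw [zero_smul, add_zero]
      exact ((contDiffAt_reducedEnergy hμ hμ2 hP).differentiableAt (by simp)).hasFDerivAt
    exact hd.comp_hasDerivAt 0 hl
  have ha : HasDerivAt (fun t : ℝ => P.2 + t * v.2) v.2 0 := hasDerivAt_line _ _ _
  have h2 : HasDerivAt (fun t : ℝ => ∑ i, pieceEnergy μ (edgeMass N M (P.1 + t • v.1) i)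
      (P.2 + t * v.2) - α / 2 * (P.2 + t * v.2) ^ 2)
      (∑ i, (-(solFreq μ (edgeMass N M P.1 i) P.2) / 2 * edgeMass N 0 v.1 i +
        solSlope μ (edgeMass N M P.1 i) P.2 * P.2 * v.2) - α * P.2 * v.2) 0 := by
    refine ((HasDerivAt.fun_sum fun i _ => hasDerivAt_pieceEnergy hμ hμ2
      (hasDerivAt_edgeMass_line M P.1 v.1 i 0) ha (by simpa using edgeMass_pos hP i)
      (by simpa using hP.2.2)).sub ((ha.pow 2).const_mul (α / 2))).congr_deriv ?_
    simp
    ring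
  have hmem : ∀ᶠ t : ℝ in 𝓝 0, P + t • v ∈ reducedDomain N M :=
    hl.continuousAt.eventually_mem ((isOpen_reducedDomain M).mem_nhds (by simpa using hP))
  refine h1.unique (h2.congr_of_eventuallyEq ?_)
  filter_upwards [hmem] with t ht
  rw [reducedEnergy_eq hμ hμ2 ht]
  rfl

/-- At a point with equal edge masses the mixed terms of the Hessian cancel, because the variations
of the edge masses have zero sum. -/
theorem fderiv_fderiv_reducedEnergy (hμ : 0 < μ) (hμ2 : μ < 2) {P : (Fin (N - 1) → ℝ) × ℝ}
    (hP : P ∈ reducedDomain N M) {m : ℝ} (hm : ∀ i, edgeMass N M P.1 i = m)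
    (v : (Fin (N - 1) → ℝ) × ℝ) :
    fderiv ℝ (fderiv ℝ (reducedEnergy N μ α M)) P v v =
      solFreq μ m P.2 * Real.tanh (solPhase μ m P.2) /
          (m * massCoordDeriv (2 / μ) (solPhase μ m P.2)) * ∑ i, edgeMass N 0 v.1 i ^ 2 +
        (N * (solSlope μ m P.2 * μ + Real.sqrt (solFreq μ m P.2) * (2 - μ) /
          massCoordDeriv (2 / μ) (solPhase μ m P.2)) + (N * solSlope μ m P.2 - α)) * v.2 ^ 2 := by
  have hl := hasDerivAt_line P v 0
  have h1 := hasDerivAt_fderiv_line (contDiffAt_reducedEnergy (α := α) hμ hμ2 hP) v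
  have ha : HasDerivAt (fun t : ℝ => P.2 + t * v.2) v.2 0 := hasDerivAt_line _ _ _
  have hi : ∀ i, 0 < edgeMass N M (P.1 + (0 : ℝ) • v.1) i := fun i => by
    simpa using edgeMass_pos hP i
  have ha0 : 0 < P.2 + 0 * v.2 := by simpa using hP.2.2
  have h2 := (HasDerivAt.fun_sum (u := Finset.univ) fun i _ =>
    hasDerivAt_pieceEnergy_differential hμ hμ2 (hasDerivAt_edgeMass_line M P.1 v.1 i 0) ha
      (hi i) ha0 (edgeMass N 0 v.1 i) v.2).sub ((ha.const_mul α).mul_const v.2)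
  have hmem : ∀ᶠ t : ℝ in 𝓝 0, P + t • v ∈ reducedDomain N M :=
    hl.continuousAt.eventually_mem ((isOpen_reducedDomain M).mem_nhds (by simpa using hP))
  refine (h1.unique (h2.congr_of_eventuallyEq ?_)).trans ?_
  · filter_upwards [hmem] with t ht
    rw [fderiv_reducedEnergy hμ hμ2 ht]
    rfl
  · have hD := massCoordDeriv_pos (by rw [lt_div_iff₀ hμ]; linarith : 1 < 2 / μ)
      (solPhase μ m P.2)
    have haP : 0 < P.2 := hP.2.2
    have hsum := sum_edgeMass 0 v.1
    simp only [zero_smul, zero_mul, add_zero, hm]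
    generalize solPhase μ m P.2 = u at *
    generalize massCoordDeriv (2 / μ) u = D at *
    generalize solFreq μ m P.2 = w at *
    generalize solSlope μ m P.2 = k at *
    have e : ∀ i ∈ (Finset.univ : Finset (Fin N)), -(w * (2 * μ * (v.2 / P.2) + 2 * Real.tanh u *
        (((2 - μ) * (v.2 / P.2) - edgeMass N 0 v.1 i / m) / D))) / 2 * edgeMass N 0 v.1 i +
        ((k * (μ * (v.2 / P.2)) + Real.sqrt w *
          (((2 - μ) * (v.2 / P.2) - edgeMass N 0 v.1 i / m) / D)) * P.2 + k * v.2) * v.2 =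
        w * Real.tanh u / (m * D) * edgeMass N 0 v.1 i ^ 2 +
        (-(w * (μ * (v.2 / P.2) + Real.tanh u * ((2 - μ) * (v.2 / P.2)) / D)) -
          Real.sqrt w * P.2 * v.2 / (m * D)) * edgeMass N 0 v.1 i +
        (k * μ + Real.sqrt w * (2 - μ) / D + k) * v.2 ^ 2 := fun i _ => by
      field_simp
      ring
    rw [Finset.sum_congr rfl e, Finset.sum_add_distrib, Finset.sum_add_distrib,
      ← Finset.mul_sum, ← Finset.mul_sum, hsum]
    simp
    ring

end ReducedEnergy

/-! ### The symmetric point of the reduced energy -/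

/-- The parameters of the pieces of `Φ_P̃` are those of `Ψ_ω`. -/
theorem solitonParam_symPoint {N : ℕ} (hN : 0 < N) {μ α M ω : ℝ} (hμ : 0 < μ) (hμ2 : μ < 2)
    (hM : 0 < M) (hω : 0 < ω) (h : starMass (symState N μ α ω) = M) :
    solitonParam μ (M / N) (soliton μ ω (symShift N μ α ω)) = (ω, symShift N μ α ω) := by
  have hm : 0 < M / N := by positivity
  have ha := soliton_pos hμ hω (symShift N μ α ω)
  exact (existsUnique_isSolitonParam hμ hμ2 hm ha).unique
    (isSolitonParam_solitonParam hμ hμ2 hm ha) (isSolitonParam_symShift hN hω h)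

/-- The phase of `Ψ_ω` on each edge is positive, and its slope at the vertex is `α / N`, which is
the balance between the `N` outgoing derivatives and the delta interaction. -/
theorem solPhase_pos_and_solSlope_symPoint {N : ℕ} (hN : 0 < N) {μ α M ω : ℝ} (hμ : 0 < μ)
    (hμ2 : μ < 2) (hα : 0 < α) (hM : 0 < M) (hω : α ^ 2 / (N : ℝ) ^ 2 < ω)
    (h : starMass (symState N μ α ω) = M) :
    0 < solPhase μ (M / N) (symPoint N μ α M ω).2 ∧
      N * solSlope μ (M / N) (symPoint N μ α M ω).2 = α := by
  have hω0 : 0 < ω := freq_pos_of_lt hω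
  have hm : 0 < M / N := by positivity
  set a := (symPoint N μ α M ω).2
  have ha : 0 < a := soliton_pos hμ hω0 _
  have hp := (isSolitonParam_iff hμ hμ2 hm ha _).1 (isSolitonParam_symShift hN hω0 h)
  obtain ⟨h1, h2⟩ := Prod.mk.inj hp
  rw [← h1, eq_div_iff (by positivity), mul_comm, mul_symShift hμ hω0] at h2
  obtain ⟨h3, h4⟩ := symShift_arg_mem hN hα hω
  refine ⟨h2 ▸ Real.artanh_pos ⟨h3, h4⟩, ?_⟩
  rw [← sqrt_solFreq_mul_tanh ha, ← h1, ← h2, Real.tanh_artanh ⟨by linarith, h4⟩]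
  field_simp

theorem mainTheorem3 (N : ℕ) [NeZero N] (hN : 3 ≤ N) (μ α M : ℝ)
    (hμ : 0 < μ) (hμ2 : μ < 2) (hα : 0 < α) (hM : 0 < M) :
    -- the functions `ω(m, a)` and `ξ(m, a)` are well defined
    (∀ m a : ℝ, 0 < m → 0 < a → ∃! p : ℝ × ℝ, IsSolitonParam μ m a p) ∧
    -- there is exactly one symmetric bound state of mass `M`
    (∃! ω : ℝ, α ^ 2 / (N : ℝ) ^ 2 < ω ∧ starMass (symState N μ α ω) = M) ∧
    ∀ ω : ℝ, α ^ 2 / (N : ℝ) ^ 2 < ω → starMass (symState N μ α ω) = M →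
      -- the point `P̃` lies in the domain and corresponds to `Ψ_ω`
      symPoint N μ α M ω ∈ reducedDomain N M ∧
      multiSoliton N μ M (symPoint N μ α M ω) = symState N μ α ω ∧
      -- it is a strict local minimum of the reduced energy
      (∀ᶠ P in 𝓝[reducedDomain N M \ {symPoint N μ α M ω}] (symPoint N μ α M ω),
        reducedEnergy N μ α M (symPoint N μ α M ω) < reducedEnergy N μ α M P) ∧
      -- it is a stationary point at which the Hessian is positive definite
      ContDiffAt ℝ 2 (reducedEnergy N μ α M) (symPoint N μ α M ω) ∧
      fderiv ℝ (reducedEnergy N μ α M) (symPoint N μ α M ω) = 0 ∧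
      ∀ v : (Fin (N - 1) → ℝ) × ℝ, v ≠ 0 →
        0 < fderiv ℝ (fderiv ℝ (reducedEnergy N μ α M)) (symPoint N μ α M ω) v v := by
  have hN0 : 0 < N := NeZero.pos N
  have hN' : (0 : ℝ) < N := by exact_mod_cast hN0
  refine ⟨fun m a hm ha => existsUnique_isSolitonParam hμ hμ2 hm ha,
    existsUnique_starMass_symState_eq hN0 hμ hμ2 hα hM, fun ω hω hmass => ?_⟩
  have hω0 : 0 < ω := freq_pos_of_lt hω
  have hm : 0 < M / N := by positivity
  have ha : 0 < (symPoint N μ α M ω).2 := soliton_pos hμ hω0 _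
  have hedge : ∀ i, edgeMass N M (symPoint N μ α M ω).1 i = M / N := edgeMass_const M
  obtain ⟨hu, hslope⟩ := solPhase_pos_and_solSlope_symPoint hN0 hμ hμ2 hα hM hω hmass
  have hdom : symPoint N μ α M ω ∈ reducedDomain N M := by
    refine ⟨fun _ => hm, ?_, ha⟩
    simp only [symPoint, Finset.sum_const, Finset.card_univ, Fintype.card_fin, nsmul_eq_mul,
      Nat.cast_pred hN0]
    field_simp
    linarith
  have hC2 := contDiffAt_reducedEnergy (α := α) hμ hμ2 hdom
  have hgrad : fderiv ℝ (reducedEnergy N μ α M) (symPoint N μ α M ω) = 0 := by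
    refine ContinuousLinearMap.ext fun v => ?_
    rw [fderiv_reducedEnergy hμ hμ2 hdom]
    simp only [hedge]
    rw [Finset.sum_add_distrib, ← Finset.mul_sum, sum_edgeMass, Finset.sum_const, Finset.card_univ,
      Fintype.card_fin, nsmul_eq_mul, ← mul_assoc, ← mul_assoc, hslope]
    simp
  have hhess : ∀ v : (Fin (N - 1) → ℝ) × ℝ, v ≠ 0 →
      0 < fderiv ℝ (fderiv ℝ (reducedEnergy N μ α M)) (symPoint N μ α M ω) v v := by
    intro v hv
    rw [fderiv_fderiv_reducedEnergy hμ hμ2 hdom hedge]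
    rw [hslope, sub_self, add_zero]
    have hk : 0 < solSlope μ (M / N) (symPoint N μ α M ω).2 :=
      pos_of_mul_pos_right (hα.trans_eq hslope.symm) hN'.le
    have hw := solFreq_pos hμ ha (M / N)
    have hT := tanh_pos hu
    have hD := massCoordDeriv_pos (by rw [lt_div_iff₀ hμ]; linarith : 1 < 2 / μ)
      (solPhase μ (M / N) (symPoint N μ α M ω).2)
    -- when `v.2 = 0`, the first `N - 1` edges already give a positive sum of squares
    by_cases h0 : v.2 = 0
    · have hv1 : v.1 ≠ 0 := fun h => hv (Prod.ext h h0)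
      obtain ⟨i, hi⟩ := Function.ne_iff.1 hv1
      have hpos : 0 < ∑ i, edgeMass N 0 v.1 i ^ 2 := by
        refine Finset.sum_pos' (fun i _ => sq_nonneg _)
          ⟨⟨i, by omega⟩, Finset.mem_univ _, ?_⟩
        rw [edgeMass_of_lt]
        exact sq_pos_of_ne_zero hi
      positivity
    · positivity
  refine ⟨hdom, ?_, ?_, hC2, hgrad, hhess⟩
  · funext i x
    simp only [multiSoliton, symState, hedge, solitonPiece]
    rw [show (symPoint N μ α M ω).2 = soliton μ ω (symShift N μ α ω) from rfl,
      solitonParam_symPoint hN0 hμ hμ2 hM hω0 hmass]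
  · exact (eventually_lt_of_fderiv_fderiv_pos hC2 hgrad hhess).filter_mono
      (nhdsWithin_mono _ fun P hP => hP.2)
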